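/- Let $(J_{i,j})_{i,j\ge 1}$ be independent identically distributed real random variables with $\mathbb E[J_{1,1}]=0$ and $\operatorname{Var}(J_{1,1})=1$. For $N\ge 1$ and $\eta\in\{0,1\}^N$ put $$H(J,\eta)=\frac1{\sqrt N}\sum_{1\le i,j\le N}J_{i,j}\,\eta_i\eta_j ,\qquad \min_{\eta\in\{0,1\}^N}H(J,\eta)=-m_{\min,N}\,N,\qquad \max_{\eta\in\{0,1\}^N}H(J,\eta)=m_{\max,N}\,N .$$ Then $m_{\min,N}$ and $m_{\max,N}$ are integrable, and the following hold. (a) As $N\to\infty$, $m_{\min,N}-\mathbb E[m_{\min,N}]\to 0$ and $m_{\max,N}-\mathbb E[m_{\max,N}]\to 0$ in probability. (b) If $\mathbb E[|J_{1,1}|^3]<\infty$, both convergences in (a) are almost sure. (c) Suppose that the couplings are strictly subgaussian, that is, $\mathbb E[\exp(sJ_{1,1})]\le \exp(s^2/2)$ for all $s\in\mathbb R$. Then there are constants $D>0$ and $K$ such that for all $z>0$ and all $N$ large enough, namely $N\ge \max(1,K/z)$, $$\mathbb P\big(|m_{\min,N}-\mathbb E[m_{\min,N}]|>Nz\big)\le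 e^{-DNz}\quad\text{and}\quad \mathbb P\big(|m_{\max,N}-\mathbb E[m_{\max,N}]|>Nz\big)\le e^{-DNz}.$$ Moreover, the convergence is exponentially fast: for every $z_0>0$ there are $D>0$ and $N_0$ such that for all $N\ge N_0$ and all $z\ge z_0$, $$\mathbb P\big(|m_{\min,N}-\mathbb E[m_{\min,N}]|>z\big)\le e^{-DNz}\quad\text{and}\quad \mathbb P\big(|m_{\max,N}-\mathbb E[m_{\max,N}]|>z\big)\le e^{-DNz}.$$ -/

import Mathlib

open MeasureTheory ProbabilityTheory Filter Topology

noncomputable section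

/-- The QUBO Hamiltonian `H(X, η) = N^{-1/2} ∑_{i,j} X_{ij} η_i η_j` of a configuration
`η ∈ {0,1}^N` with coupling matrix `X`. -/
def hamiltonian {N : ℕ} (X : Matrix (Fin N) (Fin N) ℝ) (η : Fin N → Fin 2) : ℝ :=
  (Real.sqrt N)⁻¹ * ∑ i, ∑ j, X i j * ((η i : ℕ) : ℝ) * ((η j : ℕ) : ℝ)

/-- The minimum per particle with its sign convention: `min_η H(X, η) = - minPerParticle X * N`. -/
def minPerParticle {N : ℕ} (X : Matrix (Fin N) (Fin N) ℝ) : ℝ :=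
  -(Finset.univ.inf' Finset.univ_nonempty (hamiltonian X)) / N

/-- The maximum per particle: `max_η H(X, η) = maxPerParticle X * N`. -/
def maxPerParticle {N : ℕ} (X : Matrix (Fin N) (Fin N) ℝ) : ℝ :=
  (Finset.univ.sup' Finset.univ_nonempty (hamiltonian X)) / N

/-- The random `N × N` coupling matrix: the upper left corner of the infinite random array `J`. -/
def couplings {Ω : Type*} (J : ℕ → ℕ → Ω → ℝ) (N : ℕ) (ω : Ω) : Matrix (Fin N) (Fin N) ℝ :=
  Matrix.of fun i j => J i j ω

/-- The random variable `m_{min,N}`. -/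
def mMin {Ω : Type*} (J : ℕ → ℕ → Ω → ℝ) (N : ℕ) (ω : Ω) : ℝ :=
  minPerParticle (couplings J N ω)

/-- The random variable `m_{max,N}`. -/
def mMax {Ω : Type*} (J : ℕ → ℕ → Ω → ℝ) (N : ℕ) (ω : Ω) : ℝ :=
  maxPerParticle (couplings J N ω)

end

/-! Each coupling enters `maxPerParticle` with weight at most N^{-3/2}, since η_i η_j ∈ {0,1} and a
maximum moves no more than its arguments do. So m_max is a function of n = N² independent variables
that is L-Lipschitz for ℓ¹ with L = N^{-3/2}, and nL² = 1/N. Everything else is concentration for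
such functions.

The coordinates are integrated out one at a time: averaging over one coordinate keeps both the mean
and the Lipschitz constant, so each one-variable bound tensorises by induction on n. This gives
variance at most nL² = 1/N, hence (a); third absolute central moment O(n^{3/2} L³) = O(N^{-3/2}),
which is summable, hence (b); and exponential moments at most exp(n t² L²) = exp(t²/N), that is,
variance proxy 2/N, hence (c) by Chernoff. The minimum for J is the maximum for -J, which satisfies
the same hypotheses. -/

/-- A function of `n` real variables that is `L`-Lipschitz for the `ℓ¹` distance. -/
def CoordLipschitz {n : ℕ} (L : ℝ) (f : (Fin n → ℝ) → ℝ) : Prop :=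
  ∀ x y, |f x - f y| ≤ L * ∑ i, |x i - y i|

namespace CoordLipschitz

variable {n : ℕ} {L : ℝ}

theorem continuous {f : (Fin n → ℝ) → ℝ} (hf : CoordLipschitz L f) : Continuous f := by
  rw [continuous_iff_continuousAt]
  intro x
  have h : Tendsto (fun y : Fin n → ℝ => L * ∑ i, |y i - x i|) (𝓝 x) (𝓝 0) := by
    have hc : Continuous fun y : Fin n → ℝ => L * ∑ i, |y i - x i| := by fun_prop
    simpa using hc.tendsto x
  rw [ContinuousAt, tendsto_iff_dist_tendsto_zero]
  exact squeeze_zero (fun _ => dist_nonneg) (fun y => hf y x) h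

theorem abs_le {f : (Fin n → ℝ) → ℝ} (hf : CoordLipschitz L f) (x : Fin n → ℝ) :
    |f x| ≤ |f 0| + L * ∑ i, |x i| := by
  have h := hf x 0
  simp only [Pi.zero_apply, sub_zero] at h
  linarith [abs_sub_abs_le_abs_sub (f x) (f 0)]

theorem memLp {f : (Fin n → ℝ) → ℝ} (hf : CoordLipschitz L f) {p : ENNReal}
    {μ : Measure ℝ} [IsProbabilityMeasure μ] (hμ : MemLp id p μ) :
    MemLp f p (Measure.pi fun _ => μ) := by
  have h1 : MemLp (fun x : Fin n → ℝ => |f 0| + L * ∑ i, |x i|) p (Measure.pi fun _ => μ) := by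
    have h2 : ∀ i, MemLp (fun x : Fin n → ℝ => |x i|) p (Measure.pi fun _ => μ) := fun i =>
      (hμ.comp_measurePreserving (measurePreserving_eval (fun _ : Fin n => μ) i)).abs
    have h3 : MemLp (fun x : Fin n → ℝ => ∑ i, |x i|) p (Measure.pi fun _ => μ) :=
      memLp_finsetSum _ fun i _ => h2 i
    have h4 : MemLp (fun _ : Fin n → ℝ => |f 0|) p (Measure.pi fun _ => μ) := memLp_const _
    exact h4.add (h3.const_mul L)
  refine h1.mono hf.continuous.aestronglyMeasurable (ae_of_all _ fun x => ?_)
  rw [Real.norm_eq_abs]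
  exact (hf.abs_le x).trans (le_abs_self _)

theorem cons_left {f : (Fin (n + 1) → ℝ) → ℝ} (hf : CoordLipschitz L f) (x : Fin n → ℝ) (y y' : ℝ) :
    |f (Fin.cons y x) - f (Fin.cons y' x)| ≤ L * |y - y'| := by
  simpa [Fin.sum_univ_succ] using hf (Fin.cons y x) (Fin.cons y' x)

end CoordLipschitz

/-! ### Moments of a Lipschitz function of one variable -/

section OneVariable

variable {L : ℝ} {g : ℝ → ℝ} {μ : Measure ℝ} [IsProbabilityMeasure μ]

theorem continuous_of_abs_sub_le (hg : ∀ y y', |g y - g y'| ≤ L * |y - y'|) : Continuous g := by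
  rw [continuous_iff_continuousAt]
  intro x
  have h : Tendsto (fun y => L * |y - x|) (𝓝 x) (𝓝 0) := by
    have hc : Continuous fun y => L * |y - x| := by fun_prop
    simpa using hc.tendsto x
  rw [ContinuousAt, tendsto_iff_dist_tendsto_zero]
  exact squeeze_zero (fun _ => dist_nonneg) (fun y => hg y x) h

theorem memLp_of_abs_sub_le (hg : ∀ y y', |g y - g y'| ≤ L * |y - y'|) {p : ENNReal}
    (hμ : MemLp id p μ) : MemLp g p μ := by
  have h2 : MemLp (fun _ : ℝ => |g 0|) p μ := memLp_const _
  have h3 : MemLp (fun x : ℝ => |x|) p μ := hμ.abs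
  have h1 : MemLp (fun x => |g 0| + L * |x|) p μ := h2.add (h3.const_mul L)
  refine h1.mono (continuous_of_abs_sub_le hg).aestronglyMeasurable (ae_of_all _ fun x => ?_)
  have h := hg x 0
  rw [sub_zero] at h
  rw [Real.norm_eq_abs]
  exact le_trans (by linarith [abs_sub_abs_le_abs_sub (g x) (g 0)]) (le_abs_self _)

omit [IsProbabilityMeasure μ] in
theorem integrable_exp_mul_of_abs_sub_le (hg : ∀ y y', |g y - g y'| ≤ L * |y - y'|)
    (hμ : ∀ t, Integrable (fun x => Real.exp (t * x)) μ) (t : ℝ) :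
    Integrable (fun x => Real.exp (t * g x)) μ := by
  have h1 : Integrable (fun x => Real.exp (|t| * |g 0|) * Real.exp (|t| * L * |x|)) μ :=
    (integrable_exp_mul_abs (X := fun x : ℝ => x) (hμ _) (hμ _)).const_mul _
  have := continuous_of_abs_sub_le hg
  refine h1.mono (by fun_prop) (ae_of_all _ fun x => ?_)
  have h := hg x 0
  rw [sub_zero] at h
  rw [← Real.exp_add, Real.norm_eq_abs, Real.norm_eq_abs, Real.abs_exp, Real.abs_exp,
    Real.exp_le_exp]
  calc t * g x ≤ |t| * |g x| := by rw [← abs_mul]; exact le_abs_self _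
    _ ≤ |t| * (|g 0| + L * |x|) := by
      gcongr
      linarith [abs_sub_abs_le_abs_sub (g x) (g 0)]
    _ = _ := by ring

theorem abs_integral_le_sqrt {α : Type*} [MeasurableSpace α] {ν : Measure α}
    [IsProbabilityMeasure ν] {h : α → ℝ} (hh : MemLp h 2 ν) :
    ∫ x, |h x| ∂ν ≤ √(∫ x, h x ^ 2 ∂ν) := by
  apply Real.le_sqrt_of_sq_le
  have h0 := variance_nonneg (fun x => |h x|) ν
  have ha : MemLp (fun x => |h x|) 2 ν := hh.abs
  rw [variance_eq_sub ha] at h0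
  simp only [Pi.pow_apply, sq_abs] at h0
  linarith

theorem integral_const_add {α : Type*} [MeasurableSpace α] {ν : Measure α}
    [IsProbabilityMeasure ν] {h : α → ℝ} (hh : Integrable h ν) (c : ℝ) :
    ∫ x, (c + h x) ∂ν = c + ∫ x, h x ∂ν := by
  rw [integral_add (integrable_const _) hh]
  simp

theorem integral_centered (hi : Integrable g μ) : ∫ y, (g y - ∫ z, g z ∂μ) ∂μ = 0 := by
  rw [integral_sub hi (integrable_const _)]
  simp

/-- The mean minimises the second moment, so it may be replaced by g 0, where the Lipschitz bound
gives L|y|. -/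
theorem integral_centered_sq_le (hg : ∀ y y', |g y - g y'| ≤ L * |y - y'|)
    (hμ : MemLp id 2 μ) (hv : ∫ x, x ^ 2 ∂μ ≤ 1) :
    ∫ y, (g y - ∫ z, g z ∂μ) ^ 2 ∂μ ≤ L ^ 2 := by
  have hg2 := memLp_of_abs_sub_le hg hμ
  have h1 : Var[g; μ] = ∫ y, (g y - ∫ z, g z ∂μ) ^ 2 ∂μ := variance_eq_integral hg2.aemeasurable
  have h2 : Var[fun y => g y - g 0; μ] = Var[g; μ] :=
    variance_sub_const hg2.aestronglyMeasurable _
  have hd : MemLp (fun y => g y - g 0) 2 μ := hg2.sub (memLp_const _)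
  rw [← h1, ← h2]
  refine (variance_le_expectation_sq hd.aestronglyMeasurable).trans ?_
  calc ∫ y, (g y - g 0) ^ 2 ∂μ ≤ ∫ y, L ^ 2 * y ^ 2 ∂μ := by
        refine integral_mono hd.integrable_sq (hμ.integrable_sq.const_mul _) fun y => ?_
        have h := hg y 0
        rw [sub_zero] at h
        calc (g y - g 0) ^ 2 = |g y - g 0| ^ 2 := (sq_abs _).symm
          _ ≤ (L * |y|) ^ 2 := by gcongr
          _ = _ := by rw [mul_pow, sq_abs]
    _ = L ^ 2 * ∫ y, y ^ 2 ∂μ := integral_const_mul _ _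
    _ ≤ L ^ 2 := mul_le_of_le_one_right (by positivity) hv

/-- Taylor expansion of |·|³ at a. For centred b the linear term integrates to zero, which is what
lets third moments tensorise. -/
theorem abs_add_cube_le (a b : ℝ) :
    |a + b| ^ 3 ≤ |a| ^ 3 + 3 * (a * |a|) * b + 3 * |a| * b ^ 2 + |b| ^ 3 := by
  have key : ∀ a b : ℝ, 0 ≤ a →
      |a + b| ^ 3 ≤ |a| ^ 3 + 3 * (a * |a|) * b + 3 * |a| * b ^ 2 + |b| ^ 3 := by
    intro a b ha
    rw [abs_of_nonneg ha]
    rcases le_total 0 (a + b) with hc | hc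
    · rw [abs_of_nonneg hc]
      have : b ^ 3 ≤ |b| ^ 3 := by rw [← abs_pow]; exact le_abs_self _
      linarith
    · rw [abs_of_nonpos hc, abs_of_nonpos (by linarith : b ≤ 0)]
      -- Twice this quantity is the difference of the two sides.
      have : 0 ≤ a * ((a + 3 / 2 * b) ^ 2 + 3 / 4 * b ^ 2) := by positivity
      linarith
  rcases le_total 0 a with ha | ha
  · exact key a b ha
  · have h := key (-a) (-b) (by linarith)
    rw [← neg_add, abs_neg, abs_neg, abs_neg] at h
    linarith

/-- Averaging |g y - g z| over an independent copy z, with mean of |z| at most 1, gives the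
pointwise bound L(|y| + 1). -/
theorem integral_centered_abs_cube_le (hL : 0 ≤ L) (hg : ∀ y y', |g y - g y'| ≤ L * |y - y'|)
    (hμ : MemLp id 2 μ) (hv : ∫ x, x ^ 2 ∂μ ≤ 1) (hμ3 : MemLp id 3 μ) :
    ∫ y, |g y - ∫ z, g z ∂μ| ^ 3 ∂μ ≤ L ^ 3 * ∫ y, (|y| + 1) ^ 3 ∂μ := by
  have hgi : Integrable g μ := (memLp_of_abs_sub_le hg hμ).integrable (by norm_num)
  have hi : Integrable (fun y => |y|) μ := (hμ.integrable (by norm_num)).abs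
  have hm : ∫ y, |y| ∂μ ≤ 1 := by
    refine (abs_integral_le_sqrt hμ).trans ?_
    rw [Real.sqrt_le_one]
    exact hv
  have hb : ∀ y, |g y - ∫ z, g z ∂μ| ≤ L * (|y| + 1) := fun y => by
    have e : g y - ∫ z, g z ∂μ = ∫ z, (g y - g z) ∂μ := by
      rw [integral_sub (integrable_const _) hgi]; simp
    rw [e]
    calc |∫ z, (g y - g z) ∂μ| ≤ ∫ z, |g y - g z| ∂μ := abs_integral_le_integral_abs
      _ ≤ ∫ z, L * (|y| + |z|) ∂μ := by
        refine integral_mono ((integrable_const _).sub hgi).abs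
          (((integrable_const _).add hi).const_mul _) fun z => ?_
        exact (hg y z).trans (mul_le_mul_of_nonneg_left (abs_sub _ _) hL)
      _ = L * (|y| + ∫ z, |z| ∂μ) := by
        rw [integral_const_mul, integral_add (integrable_const _) hi]; simp
      _ ≤ _ := by gcongr
  have h3 : MemLp (fun y : ℝ => |y| + 1) 3 μ := hμ3.abs.add (memLp_const _)
  have h3i : Integrable (fun y : ℝ => (|y| + 1) ^ 3) μ := by
    refine (h3.integrable_norm_pow (p := 3) (by norm_num)).congr (ae_of_all _ fun y => ?_)
    simp only [Real.norm_eq_abs]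
    rw [abs_of_nonneg (by positivity)]
  rw [← integral_const_mul]
  have hgc := continuous_of_abs_sub_le hg
  refine integral_mono_of_nonneg (ae_of_all _ fun y => by positivity) (h3i.const_mul _)
    (ae_of_all _ fun y => ?_)
  show |g y - ∫ z, g z ∂μ| ^ 3 ≤ L ^ 3 * (|y| + 1) ^ 3
  rw [← mul_pow]
  gcongr
  exact hb y

/-- Symmetrisation: the exponential moments of a Lipschitz image of a subgaussian variable. -/
theorem integral_exp_centered_le (hL : 0 ≤ L) (hg : ∀ y y', |g y - g y'| ≤ L * |y - y'|)
    (hμ : HasSubgaussianMGF id 1 μ) (t : ℝ) :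
    ∫ y, Real.exp (t * (g y - ∫ z, g z ∂μ)) ∂μ ≤ Real.exp (t ^ 2 * L ^ 2) := by
  have hex : ∀ s, Integrable (fun x => Real.exp (s * x)) μ := fun s => hμ.integrable_exp_mul s
  have hge := integrable_exp_mul_of_abs_sub_le hg hex
  have hgi : Integrable g μ := (memLp_of_abs_sub_le hg (hμ.memLp 1)).integrable (by norm_num)
  set m := ∫ z, g z ∂μ with hm
  set A := ∫ y, Real.exp (t * g y) ∂μ with hA
  set B := ∫ y, Real.exp (-t * g y) ∂μ with hB
  have hA0 : 0 ≤ A := integral_nonneg fun _ => (Real.exp_pos _).le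
  -- Jensen, from the tangent line of exp at the mean; it allows the centring factor to be replaced
  -- by an independent copy of g.
  have hjensen : Real.exp (-t * m) ≤ B := by
    have h1 : ∫ y, (Real.exp (-t * m) * (1 + -t * (g y - m))) ∂μ ≤ B := by
      refine integral_mono ?_ (hge _) fun y => ?_
      · exact ((integrable_const _).add ((hgi.sub (integrable_const _)).const_mul _)).const_mul _
      · have e : Real.exp (-t * g y) = Real.exp (-t * m) * Real.exp (-t * (g y - m)) := by
          rw [← Real.exp_add]; ring_nf
        show _ ≤ Real.exp (-t * g y)
        rw [e]
        gcongr
        linarith [Real.add_one_le_exp (-t * (g y - m))]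
    have h2 : Integrable (fun y => -t * (g y - m)) μ :=
      (hgi.sub (integrable_const _)).const_mul _
    rw [integral_const_mul, integral_const_add h2, integral_const_mul,
      integral_centered hgi] at h1
    simpa using h1
  -- Symmetrising in the two copies turns the product of exponential moments into a cosh of the
  -- difference; this is used for g and for the identity.
  have hcosh : ∀ h : ℝ → ℝ, ∀ s : ℝ, (∀ s, Integrable (fun y => Real.exp (s * h y)) μ) →
      Integrable (fun z : ℝ × ℝ => Real.cosh (s * (h z.1 - h z.2))) (μ.prod μ) ∧
      ∫ z, Real.cosh (s * (h z.1 - h z.2)) ∂(μ.prod μ)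
        = (∫ y, Real.exp (s * h y) ∂μ) * ∫ y, Real.exp (-s * h y) ∂μ := by
    intro h s hh
    have i1 : Integrable (fun z : ℝ × ℝ => Real.exp (s * h z.1) * Real.exp (-s * h z.2))
      (μ.prod μ) := (hh s).mul_prod (hh (-s))
    have i2 : Integrable (fun z : ℝ × ℝ => Real.exp (-s * h z.1) * Real.exp (s * h z.2))
      (μ.prod μ) := (hh (-s)).mul_prod (hh s)
    have e : (fun z : ℝ × ℝ => Real.cosh (s * (h z.1 - h z.2))) = fun z =>
        (Real.exp (s * h z.1) * Real.exp (-s * h z.2)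
          + Real.exp (-s * h z.1) * Real.exp (s * h z.2)) / 2 := by
      funext z
      rw [Real.cosh_eq, ← Real.exp_add, ← Real.exp_add]
      ring_nf
    rw [e]
    refine ⟨(i1.add i2).div_const _, ?_⟩
    rw [integral_div, integral_add i1 i2,
      integral_prod_mul (fun y => Real.exp (s * h y)) (fun y => Real.exp (-s * h y)),
      integral_prod_mul (fun y => Real.exp (-s * h y)) (fun y => Real.exp (s * h y))]
    ring
  obtain ⟨i1, e1⟩ := hcosh g t hge
  obtain ⟨i2, e2⟩ := hcosh id (t * L) hex
  have hmgf : ∀ s, ∫ y, Real.exp (s * y) ∂μ ≤ Real.exp (s ^ 2 / 2) := fun s => by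
    simpa [mgf] using hμ.mgf_le s
  calc ∫ y, Real.exp (t * (g y - m)) ∂μ = A * Real.exp (-t * m) := by
        rw [hA, ← integral_mul_const]
        congr with y
        rw [← Real.exp_add]; ring_nf
    _ ≤ A * B := by gcongr
    _ = _ := e1.symm
    _ ≤ ∫ z, Real.cosh (t * L * (id z.1 - id z.2)) ∂(μ.prod μ) := by
      refine integral_mono i1 i2 fun z => ?_
      -- cosh increases with the absolute value of its argument, so the Lipschitz bound on g passes
      -- through it.
      rw [Real.cosh_le_cosh, abs_mul, abs_mul, abs_mul, abs_of_nonneg hL, mul_assoc]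
      gcongr
      exact hg _ _
    _ = _ := e2
    _ ≤ Real.exp ((t * L) ^ 2 / 2) * Real.exp ((-(t * L)) ^ 2 / 2) := by
      exact mul_le_mul (hmgf _) (hmgf _) (integral_nonneg fun y => (Real.exp_pos _).le)
        (Real.exp_pos _).le
    _ = _ := by rw [← Real.exp_add]; ring_nf

end OneVariable

/-! ### Tensorisation over independent coordinates -/

section Tensorisation

variable {n : ℕ} {μ : Measure ℝ} [IsProbabilityMeasure μ]

theorem measurePreserving_cons :
    MeasurePreserving (fun z : ℝ × (Fin n → ℝ) => (Fin.cons z.1 z.2 : Fin (n + 1) → ℝ))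
      (μ.prod (Measure.pi fun _ => μ)) (Measure.pi fun _ => μ) := by
  have h := (measurePreserving_piFinSuccAbove (fun _ : Fin (n + 1) => μ) 0).symm
  convert h using 1
  funext z
  exact (Fin.insertNth_zero' z.1 z.2).symm

theorem integrable_cons {h : (Fin (n + 1) → ℝ) → ℝ} (hh : Integrable h (Measure.pi fun _ => μ)) :
    Integrable (fun z : ℝ × (Fin n → ℝ) => h (Fin.cons z.1 z.2))
      (μ.prod (Measure.pi fun _ => μ)) :=
  measurePreserving_cons.integrable_comp_of_integrable hh

theorem integral_pi_succ {h : (Fin (n + 1) → ℝ) → ℝ} (hh : Integrable h (Measure.pi fun _ => μ)) :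
    ∫ x, h x ∂(Measure.pi fun _ => μ)
      = ∫ x : Fin n → ℝ, ∫ y, h (Fin.cons y x) ∂μ ∂(Measure.pi fun _ => μ) := by
  rw [← measurePreserving_cons.map_eq, integral_map measurePreserving_cons.aemeasurable
    (by rw [measurePreserving_cons.map_eq]; exact hh.aestronglyMeasurable)]
  exact integral_prod_symm _ (integrable_cons hh)

theorem integral_pi_succ_le {h : (Fin (n + 1) → ℝ) → ℝ} (hh : Integrable h (Measure.pi fun _ => μ))
    {G : (Fin n → ℝ) → ℝ} (hG : Integrable G (Measure.pi fun _ => μ))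
    (hle : ∀ x, ∫ y, h (Fin.cons y x) ∂μ ≤ G x) :
    ∫ x, h x ∂(Measure.pi fun _ => μ) ≤ ∫ x, G x ∂(Measure.pi fun _ => μ) := by
  rw [integral_pi_succ hh]
  exact integral_mono (integrable_cons hh).integral_prod_right hG hle

variable {L : ℝ}

namespace CoordLipschitz

/-- This is what keeps the inductions going: the constant L does not deteriorate when a coordinate
is averaged out. -/
theorem integral_cons {f : (Fin (n + 1) → ℝ) → ℝ} (hf : CoordLipschitz L f)
    (hμ : Integrable id μ) : CoordLipschitz L fun x => ∫ y, f (Fin.cons y x) ∂μ := by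
  intro x x'
  have hi : ∀ x, Integrable (fun y => f (Fin.cons y x)) μ := fun x =>
    (memLp_of_abs_sub_le (hf.cons_left x) (memLp_one_iff_integrable.2 hμ)).integrable le_rfl
  rw [← integral_sub (hi x) (hi x')]
  have hb : ∀ y, |f (Fin.cons y x) - f (Fin.cons y x')| ≤ L * ∑ i, |x i - x' i| := fun y => by
    simpa [Fin.sum_univ_succ] using hf (Fin.cons y x) (Fin.cons y x')
  refine abs_integral_le_integral_abs.trans
    ((integral_mono ((hi x).sub (hi x')).abs (integrable_const _) hb).trans (by simp))

/-- Law of total variance: each coordinate contributes a conditional variance of at most L². -/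
theorem integral_centered_sq_le (hμ : MemLp id 2 μ) (hv : ∫ x, x ^ 2 ∂μ ≤ 1) :
    ∀ {n : ℕ} {f : (Fin n → ℝ) → ℝ}, CoordLipschitz L f →
      ∫ x, (f x - ∫ z, f z ∂(Measure.pi fun _ => μ)) ^ 2 ∂(Measure.pi fun _ => μ) ≤ n * L ^ 2
  | 0, f, _ => by
    rw [Measure.pi_of_empty]
    simp
  | n + 1, f, hf => by
    have hμi : Integrable id μ := hμ.integrable (by norm_num)
    have hf2 := hf.memLp hμ
    have hF := hf.integral_cons hμi
    have hF2 := hF.memLp hμ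
    have e := integral_pi_succ (hf2.integrable (by norm_num))
    set F := fun x : Fin n → ℝ => ∫ y, f (Fin.cons y x) ∂μ with hFdef
    set m := ∫ z, f z ∂(Measure.pi fun _ => μ)
    have hFm : MemLp (fun x => F x - m) 2 (Measure.pi fun _ => μ) := hF2.sub (memLp_const _)
    have hstep : ∀ x, ∫ y, (f (Fin.cons y x) - m) ^ 2 ∂μ ≤ L ^ 2 + (F x - m) ^ 2 := fun x => by
      have hg2 : MemLp (fun y => f (Fin.cons y x)) 2 μ := memLp_of_abs_sub_le (hf.cons_left x) hμ
      have hgF : MemLp (fun y => f (Fin.cons y x) - F x) 2 μ := hg2.sub (memLp_const _)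
      have hgi := hg2.integrable (by norm_num)
      -- The cross term vanishes because F x is the conditional mean.
      have e1 : ∀ y, (f (Fin.cons y x) - m) ^ 2 = (F x - m) ^ 2 +
          ((f (Fin.cons y x) - F x) ^ 2 + 2 * (F x - m) * (f (Fin.cons y x) - F x)) := fun y => by
        ring

      have i2 : Integrable (fun y => 2 * (F x - m) * (f (Fin.cons y x) - F x)) μ :=
        (hgF.integrable (by norm_num)).const_mul _
      have e2 : ∫ y, (f (Fin.cons y x) - m) ^ 2 ∂μ
          = (F x - m) ^ 2 + ∫ y, (f (Fin.cons y x) - F x) ^ 2 ∂μ := by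
        simp_rw [e1]
        have i3 : Integrable (fun y => (f (Fin.cons y x) - F x) ^ 2
          + 2 * (F x - m) * (f (Fin.cons y x) - F x)) μ := hgF.integrable_sq.add i2
        rw [integral_const_add i3, integral_add hgF.integrable_sq i2,
          integral_const_mul, integral_centered hgi, mul_zero, add_zero]
      rw [e2, add_comm]
      gcongr
      exact _root_.integral_centered_sq_le (hf.cons_left x) hμ hv
    have h1 : Integrable (fun x => (f x - m) ^ 2) (Measure.pi fun _ => μ) :=
      (hf2.sub (memLp_const m)).integrable_sq
    refine (integral_pi_succ_le h1 ((integrable_const _).add hFm.integrable_sq) hstep).trans ?_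
    have ih := integral_centered_sq_le hμ hv hF
    rw [← e] at ih
    have e3 := integral_const_add hFm.integrable_sq (L ^ 2)
    simp only [Pi.add_apply]
    rw [e3]
    push_cast
    linarith

/-- Adding a coordinate to n others costs at most L³c + 3L²·E|F - m|, and the variance bound gives
E|F - m| ≤ √n L. Summing yields order n^{3/2} L³. -/
theorem integral_centered_abs_cube_le (hL : 0 ≤ L) (hμ : MemLp id 2 μ)
    (hv : ∫ x, x ^ 2 ∂μ ≤ 1) (hμ3 : MemLp id 3 μ) :
    ∀ {n : ℕ} {f : (Fin n → ℝ) → ℝ}, CoordLipschitz L f →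
      ∫ x, |f x - ∫ z, f z ∂(Measure.pi fun _ => μ)| ^ 3 ∂(Measure.pi fun _ => μ)
        ≤ n * (3 * √n + ∫ y, (|y| + 1) ^ 3 ∂μ) * L ^ 3
  | 0, f, _ => by
    rw [Measure.pi_of_empty]
    simp
  | n + 1, f, hf => by
    have hcube : ∀ {α : Type} [MeasurableSpace α] {ν : Measure α} {h : α → ℝ}, MemLp h 3 ν →
        Integrable (fun x => |h x| ^ 3) ν := fun hh =>
      hh.integrable_norm_pow (p := 3) (by norm_num)
    have hμi : Integrable id μ := hμ.integrable (by norm_num)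
    have hf3 := hf.memLp hμ3
    have hF := hf.integral_cons hμi
    have hF3 := hF.memLp hμ3
    have hF2 := hF.memLp hμ
    have e := integral_pi_succ ((hf.memLp hμ).integrable (by norm_num))
    set F := fun x : Fin n → ℝ => ∫ y, f (Fin.cons y x) ∂μ with hFdef
    set m := ∫ z, f z ∂(Measure.pi fun _ => μ)
    set c := ∫ y, (|y| + 1) ^ 3 ∂μ
    have hFm3 : MemLp (fun x => F x - m) 3 (Measure.pi fun _ => μ) := hF3.sub (memLp_const _)
    have hFm2 : MemLp (fun x => F x - m) 2 (Measure.pi fun _ => μ) := hF2.sub (memLp_const _)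
    have hstep : ∀ x, ∫ y, |f (Fin.cons y x) - m| ^ 3 ∂μ
        ≤ L ^ 3 * c + (|F x - m| ^ 3 + 3 * L ^ 2 * |F x - m|) := fun x => by
      have hg2 : MemLp (fun y => f (Fin.cons y x)) 2 μ := memLp_of_abs_sub_le (hf.cons_left x) hμ
      have hg3 : MemLp (fun y => f (Fin.cons y x)) 3 μ := memLp_of_abs_sub_le (hf.cons_left x) hμ3
      have hb2 : MemLp (fun y => f (Fin.cons y x) - F x) 2 μ := hg2.sub (memLp_const _)
      have hb3 : MemLp (fun y => f (Fin.cons y x) - F x) 3 μ := hg3.sub (memLp_const _)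
      have hm3 : MemLp (fun y => f (Fin.cons y x) - m) 3 μ := hg3.sub (memLp_const _)
      have hgi := hg2.integrable (by norm_num)
      set a := F x - m
      have i1 : Integrable (fun y => 3 * (a * |a|) * (f (Fin.cons y x) - F x)) μ :=
        (hb2.integrable (by norm_num)).const_mul _
      have i2 : Integrable (fun y => 3 * |a| * (f (Fin.cons y x) - F x) ^ 2) μ :=
        hb2.integrable_sq.const_mul _
      have i3 : Integrable (fun y => |f (Fin.cons y x) - F x| ^ 3) μ := hcube hb3
      have i12 : Integrable (fun y => 3 * (a * |a|) * (f (Fin.cons y x) - F x)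
        + 3 * |a| * (f (Fin.cons y x) - F x) ^ 2) μ := i1.add i2
      have i123 : Integrable (fun y => 3 * (a * |a|) * (f (Fin.cons y x) - F x)
        + 3 * |a| * (f (Fin.cons y x) - F x) ^ 2 + |f (Fin.cons y x) - F x| ^ 3) μ := i12.add i3
      have h1 : ∫ y, |f (Fin.cons y x) - m| ^ 3 ∂μ ≤ ∫ y, (|a| ^ 3 +
          (3 * (a * |a|) * (f (Fin.cons y x) - F x) + 3 * |a| * (f (Fin.cons y x) - F x) ^ 2
            + |f (Fin.cons y x) - F x| ^ 3)) ∂μ := by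
        refine integral_mono (hcube hm3) ((integrable_const _).add i123) fun y => ?_
        have h := abs_add_cube_le a (f (Fin.cons y x) - F x)
        have e1 : a + (f (Fin.cons y x) - F x) = f (Fin.cons y x) - m := by ring
        rw [e1] at h
        show |f (Fin.cons y x) - m| ^ 3 ≤ _
        linarith
      rw [integral_const_add i123, integral_add i12 i3, integral_add i1 i2, integral_const_mul,
        integral_const_mul, integral_centered hgi] at h1
      have h2 := _root_.integral_centered_sq_le (hf.cons_left x) hμ hv
      have h3 := _root_.integral_centered_abs_cube_le hL (hf.cons_left x) hμ hv hμ3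
      have h4 := mul_le_mul_of_nonneg_left h2 (abs_nonneg a)
      linarith
    have j1 : Integrable (fun x => |F x - m| ^ 3) (Measure.pi fun _ => μ) := hcube hFm3
    have j2 : Integrable (fun x => 3 * L ^ 2 * |F x - m|) (Measure.pi fun _ => μ) :=
      (hFm2.integrable (by norm_num)).abs.const_mul _
    have j12 : Integrable (fun x => |F x - m| ^ 3 + 3 * L ^ 2 * |F x - m|)
      (Measure.pi fun _ => μ) := j1.add j2
    have h1 : Integrable (fun x => |f x - m| ^ 3) (Measure.pi fun _ => μ) :=
      hcube (hf3.sub (memLp_const m))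
    refine (integral_pi_succ_le h1 ((integrable_const _).add j12) hstep).trans ?_
    have ih := integral_centered_abs_cube_le hL hμ hv hμ3 hF
    have ih2 := integral_centered_sq_le hμ hv hF
    rw [← e] at ih ih2
    have e3 := integral_const_add j12 (L ^ 3 * c)
    simp only [Pi.add_apply]
    rw [e3, integral_add j1 j2, integral_const_mul]
    have h5 : ∫ x, |F x - m| ∂(Measure.pi fun _ => μ) ≤ √n * L := by
      refine (abs_integral_le_sqrt hFm2).trans ((Real.sqrt_le_sqrt ih2).trans ?_)
      rw [Real.sqrt_mul (by positivity), Real.sqrt_sq hL]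
    have h6 : 3 * L ^ 2 * ∫ x, |F x - m| ∂(Measure.pi fun _ => μ) ≤ 3 * L ^ 2 * (√n * L) := by
      gcongr
    have h7 : √(n : ℝ) ≤ √((n + 1 : ℕ) : ℝ) := Real.sqrt_le_sqrt (by push_cast; linarith)
    have h8 : (n + 1 : ℝ) * (3 * √n + c) * L ^ 3
        ≤ (n + 1 : ℝ) * (3 * √((n + 1 : ℕ) : ℝ) + c) * L ^ 3 := by gcongr
    push_cast at h8 ⊢
    linarith

theorem integrable_exp_mul {f : (Fin n → ℝ) → ℝ} (hf : CoordLipschitz L f)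
    (hμ : ∀ t, Integrable (fun x => Real.exp (t * x)) μ) (t : ℝ) :
    Integrable (fun x => Real.exp (t * f x)) (Measure.pi fun _ => μ) := by
  have h1 : Integrable (fun x : Fin n → ℝ => Real.exp (|t| * |f 0|) *
      ∏ i, Real.exp (|t| * L * |x i|)) (Measure.pi fun _ => μ) :=
    Integrable.const_mul (Integrable.fintype_prod (f := fun _ x => Real.exp (|t| * L * |x|))
      fun i => integrable_exp_mul_abs (X := fun x : ℝ => x) (hμ _) (hμ _)) _
  have := hf.continuous
  refine h1.mono (by fun_prop) (ae_of_all _ fun x => ?_)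
  rw [← Real.exp_sum, ← Real.exp_add, Real.norm_eq_abs, Real.norm_eq_abs, Real.abs_exp,
    Real.abs_exp, Real.exp_le_exp, ← Finset.mul_sum]
  calc t * f x ≤ |t| * |f x| := by rw [← abs_mul]; exact le_abs_self _
    _ ≤ |t| * (|f 0| + L * ∑ i, |x i|) := by
      gcongr
      exact hf.abs_le x
    _ = _ := by ring

/-- Conditionally on the others, each coordinate contributes a factor exp(t² L²). -/
theorem integral_exp_centered_le (hL : 0 ≤ L) (hμ : HasSubgaussianMGF id 1 μ) (t : ℝ) :
    ∀ {n : ℕ} {f : (Fin n → ℝ) → ℝ}, CoordLipschitz L f →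
      ∫ x, Real.exp (t * (f x - ∫ z, f z ∂(Measure.pi fun _ => μ))) ∂(Measure.pi fun _ => μ)
        ≤ Real.exp (n * (t ^ 2 * L ^ 2))
  | 0, f, _ => by
    rw [Measure.pi_of_empty]
    simp
  | n + 1, f, hf => by
    have hμi : Integrable id μ := hμ.integrable
    have hex : ∀ s, Integrable (fun x => Real.exp (s * x)) μ := fun s => hμ.integrable_exp_mul s
    have hF := hf.integral_cons hμi
    have e := integral_pi_succ ((hf.memLp (hμ.memLp 1)).integrable (by norm_num))
    set F := fun x : Fin n → ℝ => ∫ y, f (Fin.cons y x) ∂μ with hFdef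
    set m := ∫ z, f z ∂(Measure.pi fun _ => μ)
    have hint : ∀ {k : ℕ} {h : (Fin k → ℝ) → ℝ}, CoordLipschitz L h →
        Integrable (fun x => Real.exp (t * (h x - m))) (Measure.pi fun _ => μ) := fun hh => by
      refine ((hh.integrable_exp_mul hex t).mul_const (Real.exp (-(t * m)))).congr
        (ae_of_all _ fun x => ?_)
      simp only [← Real.exp_add]
      ring_nf
    have hstep : ∀ x, ∫ y, Real.exp (t * (f (Fin.cons y x) - m)) ∂μ
        ≤ Real.exp (t ^ 2 * L ^ 2) * Real.exp (t * (F x - m)) := fun x => by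
      have e1 : ∀ y, Real.exp (t * (f (Fin.cons y x) - m))
          = Real.exp (t * (f (Fin.cons y x) - F x)) * Real.exp (t * (F x - m)) := fun y => by
        rw [← Real.exp_add]; ring_nf
      simp_rw [e1]
      rw [integral_mul_const]
      gcongr
      exact _root_.integral_exp_centered_le hL (hf.cons_left x) hμ t
    refine (integral_pi_succ_le (hint hf) ((hint hF).const_mul _) hstep).trans ?_
    have ih := integral_exp_centered_le hL hμ t hF
    rw [← e] at ih
    rw [integral_const_mul]
    calc _ ≤ Real.exp (t ^ 2 * L ^ 2) * Real.exp (n * (t ^ 2 * L ^ 2)) := by gcongr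
      _ = _ := by rw [← Real.exp_add]; push_cast; ring_nf

end CoordLipschitz
end Tensorisation

/-! ### Lipschitz bound for the ground state energy -/

theorem neg_inf'_eq_sup'_neg {α : Type*} {s : Finset α} (hs : s.Nonempty) (f : α → ℝ) :
    -s.inf' hs f = s.sup' hs fun a => -f a := by
  refine le_antisymm ?_ (Finset.sup'_le _ _ fun a ha => neg_le_neg (Finset.inf'_le _ ha))
  rw [neg_le]
  refine Finset.le_inf' _ _ fun a ha => ?_
  rw [neg_le]
  exact Finset.le_sup' (fun a => -f a) ha

theorem hamiltonian_neg {N : ℕ} (X : Matrix (Fin N) (Fin N) ℝ) (η : Fin N → Fin 2) :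
    hamiltonian (-X) η = -hamiltonian X η := by
  simp [hamiltonian]

theorem minPerParticle_eq_maxPerParticle_neg {N : ℕ} (X : Matrix (Fin N) (Fin N) ℝ) :
    minPerParticle X = maxPerParticle (-X) := by
  have h : hamiltonian (-X) = fun η => -hamiltonian X η := funext (hamiltonian_neg X)
  rw [minPerParticle, maxPerParticle, h, neg_inf'_eq_sup'_neg]

theorem hamiltonian_sub_le {N : ℕ} (X Y : Matrix (Fin N) (Fin N) ℝ) (η : Fin N → Fin 2) :
    hamiltonian X η - hamiltonian Y η ≤ (√N)⁻¹ * ∑ i, ∑ j, |X i j - Y i j| := by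
  rw [hamiltonian, hamiltonian, ← mul_sub, ← Finset.sum_sub_distrib]
  gcongr with i _
  rw [← Finset.sum_sub_distrib]
  gcongr with j _
  have h : ∀ k : Fin 2, ((k : ℕ) : ℝ) = 0 ∨ ((k : ℕ) : ℝ) = 1 := by
    intro k; fin_cases k <;> simp
  rcases h (η i) with hi | hi <;> rcases h (η j) with hj | hj <;> rw [hi, hj] <;>
    simp [le_abs_self]

theorem maxPerParticle_sub_le {N : ℕ} (X Y : Matrix (Fin N) (Fin N) ℝ) :
    maxPerParticle X - maxPerParticle Y ≤ (√N)⁻¹ / N * ∑ i, ∑ j, |X i j - Y i j| := by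
  rw [maxPerParticle, maxPerParticle, ← sub_div, div_mul_eq_mul_div]
  gcongr
  rw [sub_le_iff_le_add]
  refine Finset.sup'_le _ _ fun η hη => ?_
  linarith [hamiltonian_sub_le X Y η, Finset.le_sup' (hamiltonian Y) hη]

/-- The matrix with entries listed by a vector of length `N * N`. -/
def matrixOfVector {N : ℕ} (x : Fin (N * N) → ℝ) : Matrix (Fin N) (Fin N) ℝ :=
  Matrix.of fun i j => x (finProdFinEquiv (i, j))

theorem coordLipschitz_maxPerParticle (N : ℕ) :
    CoordLipschitz ((√N)⁻¹ / N) fun x : Fin (N * N) → ℝ => maxPerParticle (matrixOfVector x) := by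
  have h : ∀ x y : Fin (N * N) → ℝ, ∑ i, ∑ j, |matrixOfVector x i j - matrixOfVector y i j|
      = ∑ k, |x k - y k| := fun x y => by
    rw [← finProdFinEquiv.sum_comp, Fintype.sum_prod_type]
    rfl
  intro x y
  rw [abs_sub_le_iff]
  refine ⟨h x y ▸ maxPerParticle_sub_le _ _, ?_⟩
  have e : ∑ k, |x k - y k| = ∑ k, |y k - x k| := by simp_rw [abs_sub_comm]
  rw [e]
  exact h y x ▸ maxPerParticle_sub_le _ _

/-! ### Moment bounds for the random maximum -/

section Random

variable {Ω : Type*} [MeasurableSpace Ω] {P : Measure Ω}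
  {J : ℕ → ℕ → Ω → ℝ}

/-- The entries of the coupling matrix, listed as a vector of length `N * N`. -/
def couplingVector (J : ℕ → ℕ → Ω → ℝ) (N : ℕ) (ω : Ω) (k : Fin (N * N)) : ℝ :=
  J (finProdFinEquiv.symm k).1 (finProdFinEquiv.symm k).2 ω

omit [MeasurableSpace Ω] in
theorem mMax_eq (J : ℕ → ℕ → Ω → ℝ) (N : ℕ) (ω : Ω) :
    mMax J N ω = maxPerParticle (matrixOfVector (couplingVector J N ω)) := by
  rw [mMax]
  congr 1
  ext i j
  simp only [couplings, matrixOfVector, couplingVector, Matrix.of_apply, Equiv.symm_apply_apply]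

omit [MeasurableSpace Ω] in
theorem mMin_eq (J : ℕ → ℕ → Ω → ℝ) (N : ℕ) : mMin J N = mMax (fun i j ω => -J i j ω) N :=
  funext fun ω => minPerParticle_eq_maxPerParticle_neg (couplings J N ω)

variable [IsProbabilityMeasure P]

/-- Independent identically distributed couplings. -/
structure IIDCouplings (J : ℕ → ℕ → Ω → ℝ) (P : Measure Ω) : Prop where
  meas : ∀ i j, Measurable (J i j)
  indep : iIndepFun (fun p : ℕ × ℕ => J p.1 p.2) P
  ident : ∀ i j, IdentDistrib (J i j) (J 0 0) P P

namespace IIDCouplings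

omit [IsProbabilityMeasure P] in
theorem neg (h : IIDCouplings J P) : IIDCouplings (fun i j ω => -J i j ω) P where
  meas i j := (h.meas i j).neg
  indep := h.indep.comp (fun _ x => -x) fun _ => measurable_neg
  ident i j := (h.ident i j).comp measurable_neg

/-- Distinct positions in the vector come from distinct matrix entries, so independence and equal
laws give a product measure. -/
theorem measurePreserving (h : IIDCouplings J P) (N : ℕ) :
    MeasurePreserving (couplingVector J N) P (Measure.pi fun _ => P.map (J 0 0)) := by
  have hm : ∀ k, Measurable fun ω => couplingVector J N ω k := fun k => h.meas _ _
  refine ⟨measurable_pi_lambda _ hm, ?_⟩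
  have hinj : Function.Injective fun k : Fin (N * N) =>
      (((finProdFinEquiv.symm k).1 : ℕ), ((finProdFinEquiv.symm k).2 : ℕ)) := by
    intro k l hkl
    simp only [Prod.mk.injEq] at hkl
    exact finProdFinEquiv.symm.injective (Prod.ext (Fin.ext hkl.1) (Fin.ext hkl.2))
  have hi : iIndepFun (fun k ω => couplingVector J N ω k) P := h.indep.precomp hinj
  rw [iIndepFun_iff_map_fun_eq_pi_map fun k => (hm k).aemeasurable] at hi
  refine hi.trans ?_
  congr 1
  funext k
  exact (h.ident _ _).map_eq

theorem isProbabilityMeasure_map (h : IIDCouplings J P) : IsProbabilityMeasure (P.map (J 0 0)) :=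
  Measure.isProbabilityMeasure_map (h.meas 0 0).aemeasurable

omit [IsProbabilityMeasure P] in
theorem memLp_id_map (h : IIDCouplings J P) {p : ENNReal} (hp : MemLp (J 0 0) p P) :
    MemLp id p (P.map (J 0 0)) :=
  (memLp_map_measure_iff aestronglyMeasurable_id (h.meas 0 0).aemeasurable).2 hp

theorem memLp_mMax (h : IIDCouplings J P) {p : ENNReal} (hp : MemLp (J 0 0) p P) (N : ℕ) :
    MemLp (mMax J N) p P := by
  have := h.isProbabilityMeasure_map
  have h1 := ((coordLipschitz_maxPerParticle N).memLp (h.memLp_id_map hp)).comp_measurePreserving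
    (h.measurePreserving N)
  exact h1.ae_eq (ae_of_all _ fun ω => (mMax_eq J N ω).symm)

theorem integral_mMax (h : IIDCouplings J P) (N : ℕ) {φ : ℝ → ℝ} (hφ : Continuous φ) :
    ∫ ω, φ (mMax J N ω) ∂P = ∫ x, φ (maxPerParticle (matrixOfVector x))
      ∂(Measure.pi fun _ : Fin (N * N) => P.map (J 0 0)) := by
  simp_rw [mMax_eq]
  rw [← (h.measurePreserving N).map_eq, integral_map (h.measurePreserving N).aemeasurable]
  exact (hφ.comp (coordLipschitz_maxPerParticle N).continuous).aestronglyMeasurable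

theorem integral_mMax_centered (h : IIDCouplings J P) (N : ℕ) {φ : ℝ → ℝ} (hφ : Continuous φ) :
    ∫ ω, φ (mMax J N ω - ∫ ω', mMax J N ω' ∂P) ∂P =
      ∫ x, φ (maxPerParticle (matrixOfVector x) - ∫ y, maxPerParticle (matrixOfVector y)
        ∂(Measure.pi fun _ : Fin (N * N) => P.map (J 0 0)))
        ∂(Measure.pi fun _ : Fin (N * N) => P.map (J 0 0)) := by
  have e := h.integral_mMax N continuous_id
  simp only [id_eq] at e
  rw [← e]
  exact h.integral_mMax N (φ := fun x => φ (x - ∫ ω', mMax J N ω' ∂P))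
    (hφ.comp (continuous_id.sub continuous_const))

omit [IsProbabilityMeasure P] in
theorem integral_sq_map (h : IIDCouplings J P) (hv : ∫ ω, J 0 0 ω ^ 2 ∂P ≤ 1) :
    ∫ x, x ^ 2 ∂(P.map (J 0 0)) ≤ 1 := by
  rwa [integral_map (h.meas 0 0).aemeasurable (by fun_prop)]

theorem integral_mMax_centered_sq_le (h : IIDCouplings J P) (h2 : MemLp (J 0 0) 2 P)
    (hv : ∫ ω, J 0 0 ω ^ 2 ∂P ≤ 1) (N : ℕ) :
    ∫ ω, (mMax J N ω - ∫ ω', mMax J N ω' ∂P) ^ 2 ∂P ≤ (N : ℝ)⁻¹ := by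
  have := h.isProbabilityMeasure_map
  rw [h.integral_mMax_centered N (continuous_pow 2)]
  refine (CoordLipschitz.integral_centered_sq_le (h.memLp_id_map h2) (h.integral_sq_map hv)
    (coordLipschitz_maxPerParticle N)).trans_eq ?_
  -- For N = 0 there are no coordinates, and the right side is 0 because 0⁻¹ = 0.
  rcases eq_or_ne N 0 with rfl | hN
  · simp
  · have hN' : (N : ℝ) ≠ 0 := by exact_mod_cast hN
    rw [div_pow, inv_pow, Real.sq_sqrt (by positivity)]
    push_cast
    field_simp

theorem integral_mMax_centered_abs_cube_le (h : IIDCouplings J P) (h2 : MemLp (J 0 0) 2 P)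
    (hv : ∫ ω, J 0 0 ω ^ 2 ∂P ≤ 1) (h3 : MemLp (J 0 0) 3 P) (N : ℕ) :
    ∫ ω, |mMax J N ω - ∫ ω', mMax J N ω' ∂P| ^ 3 ∂P
      ≤ (3 + ∫ x, (|x| + 1) ^ 3 ∂(P.map (J 0 0))) * (√N)⁻¹ ^ 3 := by
  have := h.isProbabilityMeasure_map
  rw [h.integral_mMax_centered N (φ := fun x => |x| ^ 3) (by fun_prop)]
  refine (CoordLipschitz.integral_centered_abs_cube_le (by positivity) (h.memLp_id_map h2)
    (h.integral_sq_map hv) (h.memLp_id_map h3) (coordLipschitz_maxPerParticle N)).trans ?_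
  set c := ∫ x, (|x| + 1) ^ 3 ∂(P.map (J 0 0))
  have hc : 0 ≤ c := integral_nonneg fun x => by positivity
  rcases eq_or_ne N 0 with rfl | hN
  · simp
  · have hN' : (1 : ℝ) ≤ N := by exact_mod_cast Nat.one_le_iff_ne_zero.2 hN
    have e : √((N * N : ℕ) : ℝ) = N := by
      push_cast
      exact Real.sqrt_mul_self (by positivity)
    rw [e, div_pow]
    push_cast
    -- Since N ≥ 1, the lower-order constant c is absorbed into cN.
    calc (N * N : ℝ) * (3 * N + c) * ((√N)⁻¹ ^ 3 / N ^ 3)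
        ≤ (N * N : ℝ) * (3 * N + c * N) * ((√N)⁻¹ ^ 3 / N ^ 3) := by
          gcongr
          exact le_mul_of_one_le_right hc hN'
      _ = _ := by field_simp

/-- With n = N² and L² = N⁻³ the exponent n t² L² is t²/N = (2/N) t²/2. -/
theorem hasSubgaussianMGF_mMax_centered (h : IIDCouplings J P)
    (hs : HasSubgaussianMGF (J 0 0) 1 P) (N : ℕ) :
    HasSubgaussianMGF (fun ω => mMax J N ω - ∫ ω', mMax J N ω' ∂P) (2 / N) P := by
  have := h.isProbabilityMeasure_map
  have hs' : HasSubgaussianMGF id 1 (P.map (J 0 0)) :=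
    (HasSubgaussianMGF.id_map_iff (h.meas 0 0).aemeasurable).2 hs
  have hf := coordLipschitz_maxPerParticle N
  constructor
  · intro t
    have h1 := (h.measurePreserving N).integrable_comp_of_integrable
      (hf.integrable_exp_mul (fun s => hs'.integrable_exp_mul s) t)
    refine (h1.mul_const (Real.exp (-(t * ∫ ω', mMax J N ω' ∂P)))).congr (ae_of_all _ fun ω => ?_)
    simp only [Function.comp_apply, ← mMax_eq, ← Real.exp_add]
    ring_nf
  · intro t
    rw [mgf, h.integral_mMax_centered N (φ := fun x => Real.exp (t * x)) (by fun_prop)]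
    refine (CoordLipschitz.integral_exp_centered_le (by positivity) hs' t hf).trans_eq ?_
    congr 1
    rcases eq_or_ne N 0 with rfl | hN
    · simp
    · have hN' : (N : ℝ) ≠ 0 := by exact_mod_cast hN
      rw [div_pow, inv_pow, Real.sq_sqrt (by positivity)]
      push_cast
      field_simp

theorem tendstoInMeasure_mMax (h : IIDCouplings J P) (h2 : MemLp (J 0 0) 2 P)
    (hv : ∫ ω, J 0 0 ω ^ 2 ∂P ≤ 1) :
    TendstoInMeasure P (fun N ω => mMax J N ω - ∫ ω', mMax J N ω' ∂P) atTop (fun _ => 0) := by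
  have hm : ∀ N, MemLp (fun ω => mMax J N ω - ∫ ω', mMax J N ω' ∂P) 2 P := fun N =>
    (h.memLp_mMax h2 N).sub (memLp_const _)
  refine tendstoInMeasure_of_tendsto_eLpNorm (p := 2) (by norm_num)
    (fun N => (hm N).aestronglyMeasurable) aestronglyMeasurable_const ?_
  have e : ∀ N : ℕ, eLpNorm ((fun ω => mMax J N ω - ∫ ω', mMax J N ω' ∂P) - fun _ => (0 : ℝ)) 2 P
      ≤ ENNReal.ofReal (√(N : ℝ)⁻¹) := fun N => by
    have e0 : ((fun ω => mMax J N ω - ∫ ω', mMax J N ω' ∂P) - fun _ => (0 : ℝ))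
        = fun ω => mMax J N ω - ∫ ω', mMax J N ω' ∂P := by ext; simp
    rw [e0, (hm N).eLpNorm_eq_integral_rpow_norm (by norm_num) (by norm_num)]
    apply ENNReal.ofReal_le_ofReal
    rw [Real.sqrt_eq_rpow]
    simp only [ENNReal.toReal_ofNat, Real.rpow_two, Real.norm_eq_abs, sq_abs, one_div]
    exact Real.rpow_le_rpow (integral_nonneg fun _ => sq_nonneg _)
      (h.integral_mMax_centered_sq_le h2 hv N) (by norm_num)
  refine tendsto_of_tendsto_of_tendsto_of_le_of_le tendsto_const_nhds ?_ (fun _ => zero_le) e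
  have h0 : Tendsto (fun N : ℕ => √(N : ℝ)⁻¹) atTop (𝓝 0) := by
    have := (Real.continuous_sqrt.tendsto 0).comp (tendsto_inv_atTop_nhds_zero_nat (𝕜 := ℝ))
    rwa [Real.sqrt_zero] at this
  simpa using ENNReal.tendsto_ofReal h0

end IIDCouplings

/-! ### From moments to almost sure convergence and tails -/

omit [IsProbabilityMeasure P] in
/-- Summable third absolute moments force almost sure convergence to zero. -/
theorem ae_tendsto_zero_of_summable_integral_abs_cube {X : ℕ → Ω → ℝ} {b : ℕ → ℝ}
    (hX : ∀ n, Integrable (fun ω => |X n ω| ^ 3) P) (hb : Summable b)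
    (hle : ∀ n, ∫ ω, |X n ω| ^ 3 ∂P ≤ b n) : ∀ᵐ ω ∂P, Tendsto (fun n => X n ω) atTop (𝓝 0) := by
  -- By Tonelli the series of cubes has finite expectation, so it converges almost surely and its
  -- terms vanish; no independence across n is needed.
  have hfin : ∫⁻ ω, ∑' n, ENNReal.ofReal (|X n ω| ^ 3) ∂P ≠ ⊤ := by
    rw [lintegral_tsum fun n => (hX n).aemeasurable.ennreal_ofReal]
    refine ne_top_of_le_ne_top hb.tsum_ofReal_ne_top (ENNReal.tsum_le_tsum fun n => ?_)
    rw [← ofReal_integral_eq_lintegral_ofReal (hX n) (ae_of_all _ fun ω => by positivity)]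
    exact ENNReal.ofReal_le_ofReal (hle n)
  have hae := ae_lt_top' (AEMeasurable.tsum
    fun n => (hX n).aemeasurable.ennreal_ofReal) hfin
  filter_upwards [hae] with ω hω
  have h0 := ENNReal.tendsto_atTop_zero_of_tsum_ne_top hω.ne
  have h1 : Tendsto (fun n => |X n ω| ^ 3) atTop (𝓝 0) := by
    have h2 := (ENNReal.tendsto_toReal ENNReal.zero_ne_top).comp h0
    rw [ENNReal.toReal_zero] at h2
    refine h2.congr fun n => ?_
    exact ENNReal.toReal_ofReal (pow_nonneg (abs_nonneg (X n ω)) 3)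
  rw [Metric.tendsto_atTop] at h1 ⊢
  intro ε hε
  obtain ⟨n₀, hn₀⟩ := h1 (ε ^ 3) (by positivity)
  refine ⟨n₀, fun n hn => ?_⟩
  have h3 := hn₀ n hn
  rw [Real.dist_0_eq_abs, abs_of_nonneg (pow_nonneg (abs_nonneg (X n ω)) 3)] at h3
  rw [Real.dist_0_eq_abs]
  exact lt_of_pow_lt_pow_left₀ 3 hε.le h3

theorem summable_inv_sqrt_cube : Summable fun N : ℕ => (√(N : ℝ))⁻¹ ^ 3 := by
  refine (Real.summable_nat_rpow_inv.2 (by norm_num : (1 : ℝ) < 3 / 2)).congr fun N => ?_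
  rw [inv_pow, Real.sqrt_eq_rpow, ← Real.rpow_natCast, ← Real.rpow_mul (by positivity)]
  norm_num

/-- Chernoff on both sides; the resulting factor 2 is bounded by e, whence the 1 in the exponent. -/
theorem measureReal_lt_abs_le {X : Ω → ℝ} {N : ℕ} (hX : HasSubgaussianMGF X (2 / N) P)
    {z : ℝ} (hz : 0 ≤ z) : P.real {ω | z < |X ω|} ≤ Real.exp (1 - N * z ^ 2 / 4) := by
  have h1 := hX.measure_ge_le hz
  have h2 := hX.neg.measure_ge_le hz
  have e : -z ^ 2 / (2 * ((2 / N : NNReal) : ℝ)) = -(N * z ^ 2 / 4) := by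
    push_cast
    rcases eq_or_ne N 0 with rfl | hN
    · simp
    · have hN' : (N : ℝ) ≠ 0 := by exact_mod_cast hN
      field_simp
      norm_num
  rw [e] at h1 h2
  have hsub : {ω | z < |X ω|} ⊆ {ω | z ≤ X ω} ∪ {ω | z ≤ (-X) ω} := fun ω hω => by
    rcases lt_abs.1 (show z < |X ω| from hω) with h | h
    · exact Or.inl h.le
    · exact Or.inr h.le
  have h3 := (measureReal_mono hsub (measure_ne_top P _)).trans (measureReal_union_le _ _)
  have h4 : (2 : ℝ) ≤ Real.exp 1 := by linarith [Real.add_one_le_exp (1 : ℝ)]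
  rw [sub_eq_add_neg, Real.exp_add]
  nlinarith [Real.exp_pos (-(N * z ^ 2 / 4))]

theorem measureReal_mul_lt_abs_le {X : Ω → ℝ} {N : ℕ} (hX : HasSubgaussianMGF X (2 / N) P)
    (hN : 1 ≤ N) {z : ℝ} (hz : 0 < z) (hK : 8 ≤ N * z) :
    P.real {ω | N * z < |X ω|} ≤ Real.exp (-(1 * N * z)) := by
  refine (measureReal_lt_abs_le hX (by positivity)).trans ?_
  rw [Real.exp_le_exp]
  have hN' : (1 : ℝ) ≤ N := by exact_mod_cast hN
  -- With u = Nz ≥ 8 and N ≥ 1, N u²/4 ≥ u²/4 ≥ 2u ≥ u + 1.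
  have h1 : (N * z : ℝ) ^ 2 ≤ N * (N * z) ^ 2 := le_mul_of_one_le_left (sq_nonneg _) hN'
  nlinarith

theorem measureReal_lt_abs_le_of_le {X : Ω → ℝ} {N : ℕ} (hX : HasSubgaussianMGF X (2 / N) P)
    {z₀ z : ℝ} (hz₀ : 0 < z₀) (hN : 8 / z₀ ^ 2 ≤ N) (hz : z₀ ≤ z) :
    P.real {ω | z < |X ω|} ≤ Real.exp (-(z₀ / 8 * N * z)) := by
  refine (measureReal_lt_abs_le hX (hz₀.le.trans hz)).trans ?_
  rw [Real.exp_le_exp]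
  rw [div_le_iff₀ (by positivity)] at hN
  -- Nz²/4 is split in half: one half is at least N z₀²/8 ≥ 1 and absorbs the additive 1, the other
  -- is at least (z₀/8)Nz.
  have h1 : (N : ℝ) * z₀ ^ 2 ≤ N * z ^ 2 := by gcongr
  have h2 : (N : ℝ) * (z₀ * z) ≤ N * z ^ 2 := by
    rw [sq]
    have := hz₀.le.trans hz
    gcongr
  linarith

theorem IIDCouplings.ae_tendsto_mMax (h : IIDCouplings J P) (h2 : MemLp (J 0 0) 2 P)
    (hv : ∫ ω, J 0 0 ω ^ 2 ∂P ≤ 1) (h3 : MemLp (J 0 0) 3 P) :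
    ∀ᵐ ω ∂P, Tendsto (fun N => mMax J N ω - ∫ ω', mMax J N ω' ∂P) atTop (𝓝 0) :=
  ae_tendsto_zero_of_summable_integral_abs_cube
    (fun N => ((h.memLp_mMax h3 N).sub (memLp_const _)).integrable_norm_pow (p := 3) (by norm_num))
    (summable_inv_sqrt_cube.mul_left _) (h.integral_mMax_centered_abs_cube_le h2 hv h3)

end Random

/-! ### The theorem -/

theorem theorem1 {Ω : Type*} [MeasurableSpace Ω] (P : Measure Ω) [IsProbabilityMeasure P]
    (J : ℕ → ℕ → Ω → ℝ)
    (hmeas : ∀ i j, Measurable (J i j))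
    (hindep : iIndepFun (fun p : ℕ × ℕ => J p.1 p.2) P)
    (hident : ∀ i j, IdentDistrib (J i j) (J 0 0) P P)
    (hmean : ∫ ω, J 0 0 ω ∂P = 0)
    (hvar : variance (J 0 0) P = 1) :
    -- the expectations are genuine
    (∀ N, Integrable (mMin J N) P ∧ Integrable (mMax J N) P) ∧
    -- (a) convergence in probability
    (TendstoInMeasure P (fun N ω => mMin J N ω - ∫ ω', mMin J N ω' ∂P) atTop (fun _ => 0) ∧
      TendstoInMeasure P (fun N ω => mMax J N ω - ∫ ω', mMax J N ω' ∂P) atTop (fun _ => 0)) ∧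
    -- (b) almost sure convergence under a finite third absolute moment
    (Integrable (fun ω => |J 0 0 ω| ^ 3) P →
      (∀ᵐ ω ∂P, Tendsto (fun N => mMin J N ω - ∫ ω', mMin J N ω' ∂P) atTop (𝓝 0)) ∧
      (∀ᵐ ω ∂P, Tendsto (fun N => mMax J N ω - ∫ ω', mMax J N ω' ∂P) atTop (𝓝 0))) ∧
    -- (c) exponential bounds for strictly subgaussian couplings
    (HasSubgaussianMGF (J 0 0) 1 P →
      -- one rate `D` for all `z > 0`, deviations of size `N * z`, and `N` large (`N ≥ K / z`)
      (∃ D : ℝ, 0 < D ∧ ∃ K : ℝ, ∀ z : ℝ, 0 < z → ∀ N : ℕ, 1 ≤ N → K ≤ N * z →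
        P.real {ω | N * z < |mMin J N ω - ∫ ω', mMin J N ω' ∂P|} ≤ Real.exp (-(D * N * z)) ∧
        P.real {ω | N * z < |mMax J N ω - ∫ ω', mMax J N ω' ∂P|} ≤ Real.exp (-(D * N * z))) ∧
      -- exponentially fast convergence: deviations of size `z`, uniformly in `z ≥ z₀`
      (∀ z₀ : ℝ, 0 < z₀ → ∃ D : ℝ, 0 < D ∧ ∃ N₀ : ℕ, ∀ N : ℕ, N₀ ≤ N → ∀ z : ℝ, z₀ ≤ z →
        P.real {ω | z < |mMin J N ω - ∫ ω', mMin J N ω' ∂P|} ≤ Real.exp (-(D * N * z)) ∧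
        P.real {ω | z < |mMax J N ω - ∫ ω', mMax J N ω' ∂P|} ≤ Real.exp (-(D * N * z)))) := by
  have h : IIDCouplings J P := ⟨hmeas, hindep, hident⟩
  have hn := h.neg
  have h2 : MemLp (J 0 0) 2 P :=
    -- The variance of a variable outside L² is 0 by convention, so variance 1 forces square
    -- integrability.
    memLp_two_of_variance_ne_zero (hmeas 0 0).aestronglyMeasurable (by rw [hvar]; norm_num)
  have hv : ∫ ω, J 0 0 ω ^ 2 ∂P ≤ 1 := by
    rw [variance_of_integral_eq_zero (hmeas 0 0).aemeasurable hmean] at hvar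
    exact hvar.le
  have hn2 : MemLp (fun ω => -J 0 0 ω) 2 P := h2.neg
  have hnv : ∫ ω, (-J 0 0 ω) ^ 2 ∂P ≤ 1 := by simpa using hv
  simp only [mMin_eq]
  refine ⟨fun N => ⟨(hn.memLp_mMax hn2 N).integrable (by norm_num),
    (h.memLp_mMax h2 N).integrable (by norm_num)⟩,
    ⟨hn.tendstoInMeasure_mMax hn2 hnv, h.tendstoInMeasure_mMax h2 hv⟩, fun hint => ?_, fun hs => ?_⟩
  · have h3 : MemLp (J 0 0) 3 P := by
      rw [← integrable_norm_rpow_iff (hmeas 0 0).aestronglyMeasurable (by norm_num) (by norm_num)]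
      refine hint.congr (ae_of_all _ fun ω => ?_)
      simp only [ENNReal.toReal_ofNat, Real.norm_eq_abs]
      exact (Real.rpow_natCast _ 3).symm
    exact ⟨hn.ae_tendsto_mMax hn2 hnv h3.neg, h.ae_tendsto_mMax h2 hv h3⟩
  · have hX := h.hasSubgaussianMGF_mMax_centered hs
    have hY := hn.hasSubgaussianMGF_mMax_centered hs.neg
    refine ⟨⟨1, one_pos, 8, fun z hz N hN hK => ⟨measureReal_mul_lt_abs_le (hY N) hN hz hK,
      measureReal_mul_lt_abs_le (hX N) hN hz hK⟩⟩, fun z₀ hz₀ => ⟨z₀ / 8, by positivity,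
      ⌈8 / z₀ ^ 2⌉₊, fun N hN z hz => ?_⟩⟩
    have hN' : 8 / z₀ ^ 2 ≤ N := Nat.ceil_le.1 hN
    exact ⟨measureReal_lt_abs_le_of_le (hY N) hz₀ hN' hz,
      measureReal_lt_abs_le_of_le (hX N) hz₀ hN' hz⟩
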